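/- A \emph{numbering} is a partial recursive function $\varphi:\mathbb N\times\mathbb N\rightharpoonup\mathbb N$; write $\varphi_e(x)=\varphi(e,x)$, and let $\min_\varphi(e)$ be the least $j$ with $\varphi_j=\varphi_e$ (equality as partial functions). A numbering $\varphi$ is \emph{acceptable} if for every numbering $\psi$ there is a computable $t:\mathbb N\to\mathbb N$ with $\varphi_{t(e)}=\psi_e$ for all $e$; it is a \emph{Kolmogorov numbering} if it is acceptable and for every numbering $\psi$ such a computable $t$ can be chosen so that, for some positive constant $c$, $t(e)\le ce+c$ for all $e$. \textbf{Theorem.} There exists a Kolmogorov numbering $\psi$ with the following property. If $f$ is a (total) computable function which maps each index $x\in\mathbb N$ to a finite list of indices containing $\min_\psi(x)$, then $|f(x)|=\Omega(x)$ for infinitely many $x$; that is, there is a constant $c>0$ (which may depend on $f$) such that the length $|f(x)|$ of the list satisfies $|f(x)|\ge c\,x$ for infinitely many $x$. -/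

import Mathlib

/-- A numbering: a partial recursive function `φ` of two arguments; `φ e` is the `e`-th
function of the numbering. -/
def IsNumbering (φ : ℕ → ℕ →. ℕ) : Prop :=
  Partrec₂ φ

/-- `f` translates the numbering `ψ` into the numbering `φ`. -/
def IsTranslation (φ ψ : ℕ → ℕ →. ℕ) (f : ℕ → ℕ) : Prop :=
  ∀ e, φ (f e) = ψ e

/-- An acceptable (Gödel) numbering: every numbering translates into it computably. -/
def IsAcceptable (φ : ℕ → ℕ →. ℕ) : Prop :=
  IsNumbering φ ∧
    ∀ ψ : ℕ → ℕ →. ℕ, IsNumbering ψ → ∃ f : ℕ → ℕ, Computable f ∧ IsTranslation φ ψ f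

/-- A Kolmogorov numbering: an acceptable numbering into which every numbering translates
by a computable function that is linearly bounded. -/
def IsKolmogorov (φ : ℕ → ℕ →. ℕ) : Prop :=
  IsAcceptable φ ∧
    ∀ ψ : ℕ → ℕ →. ℕ, IsNumbering ψ →
      ∃ f : ℕ → ℕ, Computable f ∧ IsTranslation φ ψ f ∧
        ∃ c : ℕ, 0 < c ∧ ∀ e, f e ≤ c * e + c

/-- The set of `φ`-minimal indices. -/
def minimalIndices (φ : ℕ → ℕ →. ℕ) : Set ℕ :=
  {e | ∀ j < e, φ j ≠ φ e}

/-- The least `φ`-index of the function `φ e`. -/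
noncomputable def minIndex (φ : ℕ → ℕ →. ℕ) (e : ℕ) : ℕ :=
  sInf {j | φ j = φ e}

/-- `minIndex φ e` is the unique `φ`-minimal index `j` with `φ j = φ e`. -/
theorem eq_minIndex_iff (φ : ℕ → ℕ →. ℕ) (e j : ℕ) :
    j = minIndex φ e ↔ j ∈ minimalIndices φ ∧ φ j = φ e := by
  have hmem : φ (minIndex φ e) = φ e := Nat.sInf_mem (s := {j | φ j = φ e}) ⟨e, rfl⟩
  constructor
  · rintro rfl
    refine ⟨fun i hi h => ?_, hmem⟩
    exact Nat.notMem_of_lt_sInf (s := {j | φ j = φ e}) hi (h.trans hmem)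
  · rintro ⟨hj, he⟩
    refine le_antisymm (not_lt.mp fun h => hj _ h (hmem.trans he.symm)) ?_
    exact Nat.sInf_le he

/-!
The numbering `sparseNumbering` gives every constant function a private index, the odd number
`2 * m + 1` for the function with value `m`, and uses only the multiples of `4` for a universal
numbering, in which `4 * (2 ^ k * (2 * n + 1))` is the `n`-th function of the `k`-th numbering.
Since this index is linear in `n`, the numbering is Kolmogorov.

Suppose that `f x` contains the minimal index of `x` for all `x` and is short for all large `x`.
Kleene's recursion theorem (`exists_code_avoiding`) gives a program `k` that knows its own indices
`x t = universalIndex k t` and makes the function at `x t` constant with value `m t`, where `m t`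
is chosen greedily: it is the least number different from all `m s`, `s < t`, such that
`2 * m t + 1` is not in `f (x t)`. So the minimal index of `x t` is not `2 * m t + 1`, and hence it
is a smaller index, which must be a multiple of `4`
(`minIndex_of_sparseNumbering_eq_const`). But for short lists `m t ≤ 3 * t / 2`, so there are only
about `3 * T / 4` multiples of `4` to serve the distinct functions at `x t`, `t < T`: this is
impossible for large `T`.
-/

open Nat.Partrec (Code)

/-! ### The numbering -/

/-- The index reserved for the `n`-th function of the numbering computed by the `k`-th program. -/
def universalIndex (k n : ℕ) : ℕ :=
  4 * (2 ^ k * (2 * n + 1))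

theorem universalIndex_inj {k n k' n' : ℕ} (h : universalIndex k n = universalIndex k' n') :
    k = k' ∧ n = n' := by
  have h' : 2 ^ k * (2 * n + 1) = 2 ^ k' * (2 * n' + 1) :=
    Nat.eq_of_mul_eq_mul_left (by norm_num) h
  have key : ∀ a b c d : ℕ, 2 ^ a * (2 * c + 1) = 2 ^ b * (2 * d + 1) → a ≤ b → a = b := by
    intro a b c d h hab
    obtain ⟨e, rfl⟩ := Nat.exists_eq_add_of_le hab
    rw [pow_add, mul_assoc] at h
    have h2 := Nat.eq_of_mul_eq_mul_left (pow_pos (by norm_num) a) h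
    cases e with
    | zero => rfl
    | succ e =>
      rw [pow_succ, mul_comm (2 ^ e) 2, mul_assoc] at h2
      omega
  have hk : k = k' := by
    rcases le_total k k' with hle | hle
    · exact key _ _ _ _ h' hle
    · exact (key _ _ _ _ h'.symm hle).symm
  subst hk
  have := Nat.eq_of_mul_eq_mul_left (pow_pos (by norm_num) k) h'
  exact ⟨rfl, by omega⟩

theorem primrec_universalIndex : Primrec₂ universalIndex := by
  have hpow : Primrec₂ ((· ^ ·) : ℕ → ℕ → ℕ) := Primrec₂.unpaired'.1 Nat.Primrec.pow
  exact Primrec.nat_mul.comp (.const 4) (Primrec.nat_mul.comp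
    (hpow.comp (.const 2) .fst)
    (Primrec.succ.comp (Primrec.nat_mul.comp (.const 2) .snd)))

/-- The numbering whose odd index `2 * m + 1` denotes the constant function `m`, whose index
`universalIndex k n` denotes the `n`-th function of the numbering computed by the `k`-th program,
and whose other indices denote the empty function: for these the unbounded search for a pair
`(k, n)` diverges. -/
def sparseNumbering : ℕ → ℕ →. ℕ := fun i y =>
  bif i.bodd then Part.some i.div2 else
    (Nat.rfind fun p =>
      Part.some (decide (universalIndex p.unpair.1 p.unpair.2 = i))).bind fun p =>
        Code.eval (Denumerable.ofNat Code p.unpair.1) (Nat.pair p.unpair.2 y)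

theorem isNumbering_sparseNumbering : IsNumbering sparseNumbering := by
  have hfst : Primrec fun p : ℕ => p.unpair.1 := Primrec.fst.comp Primrec.unpair
  have hsnd : Primrec fun p : ℕ => p.unpair.2 := Primrec.snd.comp Primrec.unpair
  have hsearch : Partrec fun a : ℕ × ℕ => Nat.rfind fun p =>
      Part.some (decide (universalIndex p.unpair.1 p.unpair.2 = a.1)) := by
    refine Partrec.rfind (p := fun (a : ℕ × ℕ) p =>
      Part.some (decide (universalIndex p.unpair.1 p.unpair.2 = a.1))) ?_
    refine Computable.partrec (Primrec.to_comp ?_)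
    exact Primrec.eq.decide.comp
      (primrec_universalIndex.comp (hfst.comp .snd) (hsnd.comp .snd)) (Primrec.fst.comp .fst)
  have heval : Partrec₂ fun (a : ℕ × ℕ) (p : ℕ) =>
      Code.eval (Denumerable.ofNat Code p.unpair.1) (Nat.pair p.unpair.2 a.2) := by
    refine Code.eval_part.comp (Primrec.to_comp ?_) (Primrec.to_comp ?_)
    · exact (Primrec.ofNat Code).comp (hfst.comp .snd)
    · exact Primrec₂.natPair.comp (hsnd.comp .snd) (Primrec.snd.comp .fst)
  exact Partrec.cond (Computable.nat_bodd.comp .fst)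
    (Computable.partrec (Computable.nat_div2.comp .fst)) (hsearch.bind heval)

theorem sparseNumbering_odd (m : ℕ) : sparseNumbering (2 * m + 1) = fun _ => Part.some m := by
  funext y
  simp [sparseNumbering, Nat.div2_val]

theorem sparseNumbering_universalIndex (k n y : ℕ) :
    sparseNumbering (universalIndex k n) y =
      Code.eval (Denumerable.ofNat Code k) (Nat.pair n y) := by
  have hfind : (Nat.rfind fun p =>
      Part.some (decide (universalIndex p.unpair.1 p.unpair.2 = universalIndex k n))) =
        Part.some (Nat.pair k n) := by
    refine Part.eq_some_iff.2 (Nat.mem_rfind.2 ⟨by simp, fun {p} hp => ?_⟩)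
    simp only [Part.mem_some_iff]
    refine (decide_eq_false fun h => hp.ne ?_).symm
    obtain ⟨h1, h2⟩ := universalIndex_inj h
    rw [← h1, ← h2, Nat.pair_unpair]
  have hbodd : (universalIndex k n).bodd = false := by simp [universalIndex]
  simp [sparseNumbering, hfind, hbodd]

theorem four_dvd_of_mem_sparseNumbering {m i y : ℕ} (h : m ∈ sparseNumbering (2 * i) y) :
    4 ∣ 2 * i := by
  simp only [sparseNumbering, Nat.bodd_mul, Nat.bodd_two, Bool.false_and, cond_false,
    Part.mem_bind_iff] at h
  obtain ⟨p, hp, -⟩ := h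
  have := Nat.rfind_spec hp
  simp only [Part.mem_some_iff, true_eq_decide_iff] at this
  exact ⟨_, this.symm⟩

theorem isKolmogorov_sparseNumbering : IsKolmogorov sparseNumbering := by
  have key : ∀ χ : ℕ → ℕ →. ℕ, IsNumbering χ → ∃ f : ℕ → ℕ, Computable f ∧
      IsTranslation sparseNumbering χ f ∧ ∃ c : ℕ, 0 < c ∧ ∀ e, f e ≤ c * e + c := by
    intro χ hχ
    obtain ⟨c, hc⟩ := Code.exists_code.1 (Partrec₂.unpaired'.2 hχ)
    refine ⟨universalIndex (Encodable.encode c), ?_, ?_, 8 * 2 ^ Encodable.encode c,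
      by positivity, ?_⟩
    · exact (primrec_universalIndex.comp (.const _) .id).to_comp
    · intro e
      funext y
      rw [sparseNumbering_universalIndex, Denumerable.ofNat_encode, hc]
      simp [Nat.unpaired]
    · intro e
      unfold universalIndex
      nlinarith [pow_pos (show 0 < 2 by norm_num) (Encodable.encode c)]
  refine ⟨⟨isNumbering_sparseNumbering, fun χ hχ => ?_⟩, key⟩
  obtain ⟨f, hf, ht, -⟩ := key χ hχ
  exact ⟨f, hf, ht⟩

theorem minIndex_spec (φ : ℕ → ℕ →. ℕ) (e : ℕ) : φ (minIndex φ e) = φ e :=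
  ((eq_minIndex_iff φ e _).1 rfl).2

/-- The minimal index of a constant function is its reserved odd index or a smaller multiple of
`4`. -/
theorem minIndex_of_sparseNumbering_eq_const {x m : ℕ}
    (h : sparseNumbering x = fun _ => Part.some m) :
    minIndex sparseNumbering x = 2 * m + 1 ∨
      ∃ q, minIndex sparseNumbering x = 4 * q ∧ 2 * q ≤ m := by
  have hle : minIndex sparseNumbering x ≤ 2 * m + 1 :=
    Nat.sInf_le ((sparseNumbering_odd m).trans h.symm)
  have hspec := (minIndex_spec sparseNumbering x).trans h
  generalize minIndex sparseNumbering x = i at hle hspec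
  obtain ⟨j, rfl | rfl⟩ := i.even_or_odd'
  · obtain ⟨q, hq⟩ := four_dvd_of_mem_sparseNumbering (m := m) (y := 0) (i := j) (by simp [hspec])
    exact Or.inr ⟨q, hq, by omega⟩
  · rw [sparseNumbering_odd] at hspec
    have : j = m := Part.some_injective (congrFun hspec 0)
    exact Or.inl (by omega)

/-! ### The greedy choice of constants -/

theorem exists_le_length_odd_notMem (l : List ℕ) : ∃ m ≤ l.length, 2 * m + 1 ∉ l := by
  by_contra! h
  have hsub : (Finset.range (l.length + 1)).image (fun m => 2 * m + 1) ⊆ l.toFinset := by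
    intro a ha
    obtain ⟨m, hm, rfl⟩ := Finset.mem_image.1 ha
    exact List.mem_toFinset.2 (h m (Nat.lt_succ_iff.1 (Finset.mem_range.1 hm)))
  have := (Finset.card_le_card hsub).trans l.toFinset_card_le
  rw [Finset.card_image_of_injective _ (fun a b h => by simpa using h), Finset.card_range] at this
  omega

/-- The least `m` such that `2 * m + 1` does not occur in the list. -/
def leastAvoiding (l : List ℕ) : ℕ :=
  Nat.find (p := fun m => 2 * m + 1 ∉ l) ((exists_le_length_odd_notMem l).imp fun _ h => h.2)

theorem leastAvoiding_notMem (l : List ℕ) : 2 * leastAvoiding l + 1 ∉ l :=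
  Nat.find_spec (p := fun m => 2 * m + 1 ∉ l) _

theorem leastAvoiding_le (l : List ℕ) : leastAvoiding l ≤ l.length := by
  obtain ⟨m, hm, hl⟩ := exists_le_length_odd_notMem l
  exact (Nat.find_min' _ hl).trans hm

theorem computable_leastAvoiding : Computable leastAvoiding := by
  have hmem : PrimrecRel fun (l : List ℕ) (m : ℕ) => ¬ ∃ a ∈ l, a = 2 * m + 1 := by
    refine PrimrecRel.not (PrimrecRel.exists_mem_list (R := fun a m => a = 2 * m + 1) ?_)
    exact Primrec.eq.comp .fst (Primrec.succ.comp (Primrec.nat_mul.comp (.const 2) .snd))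
  refine Partrec.of_eq_tot (f := fun l => Nat.rfind fun m =>
    Part.some (decide (¬ ∃ a ∈ l, a = 2 * m + 1))) ?_ fun l => ?_
  · exact Partrec.rfind (p := fun l m => Part.some (decide (¬ ∃ a ∈ l, a = 2 * m + 1)))
      (Computable.partrec hmem.decide.to_comp)
  · refine Nat.mem_rfind.2 ⟨?_, fun {m} hm => ?_⟩
    · simpa using leastAvoiding_notMem l
    · simpa using Nat.find_min _ hm

/-- The reserved odd indices of the first `t` constants of the greedy choice that avoids the lists
`g 0`, `g 1`, …. -/
def greedyIndices (g : ℕ → List ℕ) (t : ℕ) : List ℕ :=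
  Nat.rec [] (fun s l => (2 * leastAvoiding (l ++ g s) + 1) :: l) t

/-- The `t`-th constant of the greedy choice: the least one that has not been chosen before and
whose reserved odd index is not in `g t`. -/
def greedyConst (g : ℕ → List ℕ) (t : ℕ) : ℕ :=
  leastAvoiding (greedyIndices g t ++ g t)

theorem greedyIndices_succ (g : ℕ → List ℕ) (t : ℕ) :
    greedyIndices g (t + 1) = (2 * greedyConst g t + 1) :: greedyIndices g t :=
  rfl

theorem length_greedyIndices (g : ℕ → List ℕ) (t : ℕ) : (greedyIndices g t).length = t := by
  induction t with
  | zero => rfl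
  | succ t ih => rw [greedyIndices_succ, List.length_cons, ih]

theorem greedyConst_mem (g : ℕ → List ℕ) {s t : ℕ} (h : s < t) :
    2 * greedyConst g s + 1 ∈ greedyIndices g t := by
  induction t with
  | zero => omega
  | succ t ih =>
    rw [greedyIndices_succ, List.mem_cons]
    rcases Nat.lt_succ_iff_lt_or_eq.1 h with h | rfl
    · exact Or.inr (ih h)
    · exact Or.inl rfl

theorem greedyConst_notMem (g : ℕ → List ℕ) (t : ℕ) : 2 * greedyConst g t + 1 ∉ g t :=
  fun h => leastAvoiding_notMem _ (List.mem_append_right _ h)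

theorem greedyConst_le (g : ℕ → List ℕ) (t : ℕ) : greedyConst g t ≤ t + (g t).length := by
  simpa [greedyConst, length_greedyIndices] using leastAvoiding_le (greedyIndices g t ++ g t)

theorem greedyConst_injective (g : ℕ → List ℕ) : Function.Injective (greedyConst g) := by
  have key : ∀ s t, s < t → greedyConst g s ≠ greedyConst g t := fun s t hst h =>
    leastAvoiding_notMem _ (List.mem_append_left _ (h ▸ greedyConst_mem g hst))
  intro s t h
  by_contra hne
  rcases lt_or_gt_of_ne hne with hlt | hlt
  · exact key _ _ hlt h
  · exact key _ _ hlt h.symm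

theorem computable_greedyConst {α : Type*} [Primcodable α] {g : α → ℕ → List ℕ}
    (hg : Computable₂ g) : Computable₂ fun a t => greedyConst (g a) t := by
  have hind : Computable₂ fun a t => greedyIndices (g a) t := by
    refine Computable.nat_rec (f := fun p : α × ℕ => p.2) (g := fun _ => ([] : List ℕ))
      (h := fun p q => (2 * leastAvoiding (q.2 ++ g p.1 q.1) + 1) :: q.2) .snd (.const _) ?_
    have hl : Computable fun z : (α × ℕ) × ℕ × List ℕ => z.2.2 := Computable.snd.comp .snd
    have hgz : Computable fun z : (α × ℕ) × ℕ × List ℕ => g z.1.1 z.2.1 :=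
      hg.comp (Computable.fst.comp .fst) (Computable.fst.comp .snd)
    have hodd : Computable fun m : ℕ => 2 * m + 1 :=
      (Primrec.succ.comp (Primrec.nat_mul.comp (.const 2) .id)).to_comp
    exact Computable.list_cons.comp
      (hodd.comp (computable_leastAvoiding.comp (Computable.list_append.comp hl hgz))) hl
  exact computable_leastAvoiding.comp (Computable.list_append.comp hind hg)

/-! ### Diagonalization against a list-valued function -/

/-- By the recursion theorem, some program makes each of its indices `universalIndex k t` denote
the constant chosen greedily against the lists that `f` assigns to these very indices. -/
theorem exists_code_avoiding {f : ℕ → List ℕ} (hf : Computable f) :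
    ∃ k : ℕ, ∀ t, sparseNumbering (universalIndex k t) =
      fun _ => Part.some (greedyConst (fun s => f (universalIndex k s)) t) := by
  have hg : Computable₂ fun (c : Code) (s : ℕ) => f (universalIndex (Encodable.encode c) s) :=
    hf.comp (primrec_universalIndex.to_comp.comp (Computable.encode.comp .fst) .snd)
  have hF : Partrec₂ fun (c : Code) (z : ℕ) => Part.some
      (greedyConst (fun s => f (universalIndex (Encodable.encode c) s)) z.unpair.1) :=
    Computable.partrec ((computable_greedyConst hg).comp .fst
      (Computable.fst.comp (Computable.unpair.comp .snd)))
  obtain ⟨c, hc⟩ := Code.fixed_point₂ hF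
  refine ⟨Encodable.encode c, fun t => ?_⟩
  funext y
  rw [sparseNumbering_universalIndex, Denumerable.ofNat_encode, hc]
  simp

theorem theoremt :
    ∃ ψ : ℕ → ℕ →. ℕ, IsKolmogorov ψ ∧
      ∀ f : ℕ → List ℕ, Computable f → (∀ x, minIndex ψ x ∈ f x) →
        ∃ c : ℝ, 0 < c ∧ {x : ℕ | c * (x : ℝ) ≤ ((f x).length : ℝ)}.Infinite := by
  refine ⟨sparseNumbering, isKolmogorov_sparseNumbering, fun f hf hmin => ?_⟩
  obtain ⟨k, hk⟩ := exists_code_avoiding hf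
  -- `universalIndex k t ≤ 8 * 2 ^ k * (t + 1)`, so this constant makes a short list at
  -- `universalIndex k t` have fewer than `(t + 1) / 2` entries.
  refine ⟨1 / (16 * 2 ^ k), by positivity, fun hfin => ?_⟩
  obtain ⟨b, hb⟩ := hfin.bddAbove
  set m := greedyConst fun s => f (universalIndex k s)
  have hlt : ∀ t, t < universalIndex k t := fun t => by
    unfold universalIndex
    nlinarith [Nat.one_le_two_pow (n := k)]
  have hshort : ∀ t, b ≤ t → 2 * (f (universalIndex k t)).length ≤ t := by
    intro t ht
    by_contra! hlong
    refine absurd (hb (a := universalIndex k t) ?_) (not_le.2 (ht.trans_lt (hlt t)))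
    have hlong' : (t : ℝ) + 1 ≤ 2 * ((f (universalIndex k t)).length : ℝ) := by
      exact_mod_cast hlong
    have hpos : (0 : ℝ) < 2 ^ k := by positivity
    rw [Set.mem_ofPred_eq, one_div, inv_mul_le_iff₀ (by positivity)]
    unfold universalIndex at hlong' ⊢
    push_cast
    nlinarith
  have hquarter : ∀ t, b ≤ t → ∃ q, minIndex sparseNumbering (universalIndex k t) = 4 * q ∧
      4 * q ≤ 3 * t := by
    intro t ht
    rcases minIndex_of_sparseNumbering_eq_const (hk t) with h | ⟨q, hq, hle⟩
    · refine absurd (hmin (universalIndex k t)) ?_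
      rw [h]
      exact greedyConst_notMem (fun s => f (universalIndex k s)) t
    · have h1 : m t ≤ t + (f (universalIndex k t)).length := greedyConst_le _ t
      have h2 := hshort t ht
      exact ⟨q, hq, by omega⟩
  choose! q hq hq_le using hquarter
  -- The `3 * b + 8` arguments from `b` on have distinct quarter indices, all at most
  -- `3 * (4 * b + 7) / 4 < 3 * b + 6`.
  have hmaps : Set.MapsTo q (Finset.Ico b (4 * b + 8)) (Finset.range (3 * b + 6)) := by
    intro t ht
    rw [Finset.mem_coe, Finset.mem_Ico] at ht
    have := hq_le t ht.1
    exact Finset.mem_coe.2 (Finset.mem_range.2 (by omega))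
  have hinj : Set.InjOn q (Finset.Ico b (4 * b + 8)) := by
    intro s hs t ht hst
    rw [Finset.mem_coe, Finset.mem_Ico] at hs ht
    have hidx : minIndex sparseNumbering (universalIndex k s) =
        minIndex sparseNumbering (universalIndex k t) := by
      rw [hq s hs.1, hq t ht.1, hst]
    have hfun := minIndex_spec sparseNumbering (universalIndex k s)
    rw [hidx, minIndex_spec sparseNumbering, hk, hk] at hfun
    exact (greedyConst_injective _ (Part.some_injective (congrFun hfun 0))).symm
  have hcard := Finset.card_le_card_of_injOn q hmaps hinj
  rw [Nat.card_Ico, Finset.card_range] at hcard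
  omega
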